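/- Let $H,E$ be non-zero real $L\times K$ matrices with $d=\operatorname{rank} H<\min(L,K)$, and let $\|\cdot\|$ denote the spectral norm. Let $P_0$ be the orthogonal projector of $\mathbb R^L$ onto the kernel of $HH^{\rm T}$ (the eigenspace of its zero eigenvalue), let $P_0^\perp=I-P_0$, let $S_0$ be the (Moore–Penrose) pseudoinverse of $HH^{\rm T}$, and let $\mu_{\min}$ be the smallest positive eigenvalue of $HH^{\rm T}$. For $\delta\in\mathbb R$ let $P_0^\perp(\delta)$ be the orthogonal projector onto the linear space spanned by the $d$ leading left singular vectors of $H+\delta E$ (equivalently, the $d$ leading eigenvectors of $(H+\delta E)(H+\delta E)^{\rm T}$), and put $$\mathbf B(\delta)=\delta\,(HE^{\rm T}+EH^{\rm T})+\delta^2EE^{\rm T},\qquad B(\delta)=|\delta|\,\|HE^{\rm T}+EH^{\rm T}\|+\delta^2\|EE^{\rm T}\|.$$ Let $\delta_0>0$ satisfy $B(\delta_0)=\mu_{\min}/2$. Then the following assertions are equivalent: 1. $P_0^\perp(\delta)=P_0^\perp$ for all $\delta\in(-\delta_0,\delta_0)$; 2. $S_0HE^{\rm T}P_0=0$ and $S_0EE^{\rm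 T}P_0=0$; 3. $S_0\mathbf B(\delta)P_0=0$ for all $\delta$ in some neighbourhood of zero; 4. $S_0HE^{\rm T}P_0+P_0HE^{\rm T}S_0=0$ and $S_0EE^{\rm T}P_0+P_0EE^{\rm T}S_0=0$; 5. $HE^{\rm T}P_0=0$ and $H^{\rm T}EE^{\rm T}P_0=0$. -/

import Mathlib

open scoped Matrix Topology

noncomputable section SignalSubspace

/-- The matrix, in the standard basis, of the orthogonal projector of `ℝ^L` onto the
linear subspace `U`. -/
def projMatrix {L : ℕ} (U : Submodule ℝ (EuclideanSpace ℝ (Fin L))) :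
    Matrix (Fin L) (Fin L) ℝ :=
  Matrix.toEuclideanLin.symm (U.starProjection : EuclideanSpace ℝ (Fin L) →ₗ[ℝ] _)

/-- `X` is the (Moore-Penrose) pseudoinverse of the real matrix `M`. -/
structure IsPseudoinverse {L K : ℕ} (M : Matrix (Fin L) (Fin K) ℝ)
    (X : Matrix (Fin K) (Fin L) ℝ) : Prop where
  mul_mul_self : M * X * M = M
  self_mul_mul : X * M * X = X
  symm_left : (M * X)ᵀ = M * X
  symm_right : (X * M)ᵀ = X * M

theorem isHermitian_mul_transpose {L K : ℕ} (H : Matrix (Fin L) (Fin K) ℝ) :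
    (H * Hᵀ).IsHermitian := by
  simpa using Matrix.isHermitian_mul_conjTranspose_self H

/-- The kernel `U₀` of `H Hᵀ`, that is, the eigenspace of its zero eigenvalue. -/
def U0 {L K : ℕ} (H : Matrix (Fin L) (Fin K) ℝ) :
    Submodule ℝ (EuclideanSpace ℝ (Fin L)) :=
  Module.End.eigenspace (Matrix.toEuclideanLin (H * Hᵀ)) 0

/-- `P₀`: the orthogonal projector onto `U₀`. -/
def P0 {L K : ℕ} (H : Matrix (Fin L) (Fin K) ℝ) : Matrix (Fin L) (Fin L) ℝ :=
  projMatrix (U0 H)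

/-- `P₀⊥ = I - P₀`: the orthogonal projector onto the signal subspace `U₀⊥`. -/
def P0perp {L K : ℕ} (H : Matrix (Fin L) (Fin K) ℝ) : Matrix (Fin L) (Fin L) ℝ :=
  1 - P0 H

/-- `S₀`: the pseudoinverse of `H Hᵀ`, obtained from an orthogonal diagonalization of `H Hᵀ`
by inverting the nonzero eigenvalues (and keeping the zero ones, since `0⁻¹ = 0`). -/
def S0 {L K : ℕ} (H : Matrix (Fin L) (Fin K) ℝ) : Matrix (Fin L) (Fin L) ℝ :=
  (isHermitian_mul_transpose H).cfc (fun μ => μ⁻¹)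

/-- `S₀` is indeed the Moore-Penrose pseudoinverse of `H Hᵀ`. -/
theorem isPseudoinverse_S0 {L K : ℕ} (H : Matrix (Fin L) (Fin K) ℝ) :
    IsPseudoinverse (H * Hᵀ) (S0 H) := by
  have hA := isHermitian_mul_transpose H
  have hsa : IsSelfAdjoint (H * Hᵀ) := hA
  have hS : S0 H = cfc (fun μ : ℝ => μ⁻¹) (H * Hᵀ) := (hA.cfc_eq _).symm
  have hfin : (spectrum ℝ (H * Hᵀ)).Finite := Matrix.finite_real_spectrum
  have hc : ∀ f : ℝ → ℝ, ContinuousOn f (spectrum ℝ (H * Hᵀ)) := fun f => hfin.continuousOn f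
  have hid : cfc (fun μ : ℝ => μ) (H * Hᵀ) = H * Hᵀ := cfc_id' ℝ _
  have h1 : (H * Hᵀ) * S0 H = cfc (fun μ : ℝ => μ * μ⁻¹) (H * Hᵀ) := by
    rw [hS, cfc_mul (fun μ : ℝ => μ) _ _ (hc _) (hc _), hid]
  have h2 : S0 H * (H * Hᵀ) = cfc (fun μ : ℝ => μ⁻¹ * μ) (H * Hᵀ) := by
    rw [hS, cfc_mul _ (fun μ : ℝ => μ) _ (hc _) (hc _), hid]
  have hsym : ∀ f : ℝ → ℝ, (cfc f (H * Hᵀ))ᵀ = cfc f (H * Hᵀ) := fun f => by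
    have h : IsSelfAdjoint (cfc f (H * Hᵀ)) := cfc_predicate f (H * Hᵀ)
    simpa [IsSelfAdjoint, Matrix.star_eq_conjTranspose] using h
  refine ⟨?_, ?_, ?_, ?_⟩
  · rw [h1]
    nth_rewrite 2 [← hid]
    rw [← cfc_mul _ _ _ (hc _) (hc _)]
    simp only [mul_inv_mul_cancel]
    exact hid
  · rw [h2, hS, ← cfc_mul _ _ _ (hc _) (hc _)]
    congr 1
    funext μ
    by_cases h : μ = 0 <;> simp [h]
  · rw [h1, hsym]
  · rw [h2, hsym]

/-- The least positive eigenvalue of `H Hᵀ`. (For `H ≠ 0` the set is finite and nonempty, so that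
the infimum is a minimum.) -/
def muMin {L K : ℕ} (H : Matrix (Fin L) (Fin K) ℝ) : ℝ :=
  sInf {μ : ℝ | 0 < μ ∧ Module.End.HasEigenvalue (Matrix.toEuclideanLin (H * Hᵀ)) μ}

/-- The perturbation `B(δ) = δ (H Eᵀ + E Hᵀ) + δ² E Eᵀ` of `H Hᵀ`, as a matrix. -/
def Bmat {L K : ℕ} (H E : Matrix (Fin L) (Fin K) ℝ) (δ : ℝ) : Matrix (Fin L) (Fin L) ℝ :=
  δ • (H * Eᵀ + E * Hᵀ) + δ ^ 2 • (E * Eᵀ)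

open scoped Matrix.Norms.L2Operator in
/-- The number `B(δ) = |δ| ‖H Eᵀ + E Hᵀ‖ + δ² ‖E Eᵀ‖`, where `‖·‖` is the spectral norm. -/
def Bnorm {L K : ℕ} (H E : Matrix (Fin L) (Fin K) ℝ) (δ : ℝ) : ℝ :=
  |δ| * ‖H * Eᵀ + E * Hᵀ‖ + δ ^ 2 * ‖E * Eᵀ‖

/-- The linear space spanned by the `d` leading left singular vectors of `M`, i.e. by the
eigenvectors of `M Mᵀ` that belong to its `d` largest eigenvalues, counted with multiplicity.
(Mathlib's orthonormal eigenbasis of a symmetric operator lists the eigenvectors in decreasing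
order of eigenvalues; if the `d`-th eigenvalue is larger than the next one, the space does not
depend on the choice of this basis.) -/
def leadingSubspace {L K : ℕ} (M : Matrix (Fin L) (Fin K) ℝ) (d : ℕ) :
    Submodule ℝ (EuclideanSpace ℝ (Fin L)) :=
  Submodule.span ℝ
    {v | ∃ i : Fin L, (i : ℕ) < d ∧
      v = (Matrix.isSymmetric_toEuclideanLin_iff.mpr
        (isHermitian_mul_transpose M)).eigenvectorBasis finrank_euclideanSpace_fin i}

/-- `P₀⊥(δ)`: the orthogonal projector onto the span of the `d = rank H` leading left singular
vectors of the perturbed matrix `H + δ E`. -/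
def P0perpPert {L K : ℕ} (H E : Matrix (Fin L) (Fin K) ℝ) (δ : ℝ) :
    Matrix (Fin L) (Fin L) ℝ :=
  projMatrix (leadingSubspace (H + δ • E) H.rank)

end SignalSubspace

/-! Every assertion says that `B(δ)` maps the kernel `U₀` of `H Hᵀ` into itself. Since `Hᵀ P₀ = 0`,
one has `B(δ) P₀ = δ H Eᵀ P₀ + δ² E Eᵀ P₀`, and the two coefficients of a polynomial vanishing near
zero vanish separately. As `S₀` has the same kernel as `Hᵀ` and is injective on the range of `H`,
the factors `S₀` can be removed.

If the leading space is `U₀ᗮ`, it is invariant under the symmetric perturbed Gram matrix, hence so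
is `U₀`. Conversely, if `U₀` is invariant, then `‖B(δ)‖ < μ_min / 2` keeps the quadratic form below
`μ_min / 2` on `U₀` and above it on `U₀ᗮ`, so the `d` leading eigenvectors span `U₀ᗮ`
(`span_leading_eigenvectors_eq_orthogonal`). No perturbation series is needed. -/

/-- If a symmetric operator `T` leaves `U` invariant and its quadratic form lies above the level
`c` on `Uᗮ` and below it on `U`, then the leading `d = finrank Uᗮ` eigenvectors span `Uᗮ`. -/
theorem span_leading_eigenvectors_eq_orthogonal {V : Type*} [NormedAddCommGroup V]
    [InnerProductSpace ℝ V] [FiniteDimensional ℝ V] {n d : ℕ} {T : V →ₗ[ℝ] V}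
    (hT : T.IsSymmetric) (hn : Module.finrank ℝ V = n) (U : Submodule ℝ V)
    (hU : ∀ w ∈ U, T w ∈ U) (hd : Module.finrank ℝ U + d = n) (c : ℝ)
    (hlow : ∀ w ∈ U, w ≠ 0 → inner ℝ w (T w) < c * inner ℝ w w)
    (hhigh : ∀ u ∈ Uᗮ, u ≠ 0 → c * inner ℝ u u < inner ℝ u (T u)) :
    Submodule.span ℝ {v | ∃ i : Fin n, (i : ℕ) < d ∧ v = hT.eigenvectorBasis hn i} = Uᗮ := by
  have hUperp : ∀ u ∈ Uᗮ, T u ∈ Uᗮ := fun u hu => by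
    rw [Submodule.mem_orthogonal] at hu ⊢
    intro w hw
    rw [← hT w u]
    exact hu _ (hU w hw)
  set b := hT.eigenvectorBasis hn
  set ev := hT.eigenvalues hn
  have hTb : ∀ i, T (b i) = ev i • b i := fun i =>
    hT.apply_eigenvectorBasis hn i
  -- Both components of an eigenvector satisfy its eigenvalue equation, because `U` and `Uᗮ` are
  -- invariant and meet only in zero; the level `c` then rules out one of them.
  have hsplit : ∀ i, ∃ w ∈ U, ∃ u ∈ Uᗮ, b i = w + u ∧ T w = ev i • w ∧ T u = ev i • u := by
    intro i
    obtain ⟨w, hw, u, hu, hwu⟩ := U.exists_add_mem_mem_orthogonal (b i)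
    have h : (T w - ev i • w) + (T u - ev i • u) = 0 := by
      have := hTb i
      rw [hwu, map_add, smul_add] at this
      rw [sub_add_sub_comm, this, sub_self]
    have h1 : T w - ev i • w ∈ U := U.sub_mem (hU w hw) (U.smul_mem _ hw)
    have h2 : T u - ev i • u ∈ Uᗮ := Uᗮ.sub_mem (hUperp u hu) (Uᗮ.smul_mem _ hu)
    have h3 : T w - ev i • w = 0 := by
      have h4 : T w - ev i • w ∈ Uᗮ := by
        rw [eq_neg_of_add_eq_zero_left h]; exact Uᗮ.neg_mem h2
      exact inner_self_eq_zero.mp (h4 _ h1)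
    rw [h3, zero_add] at h
    exact ⟨w, hw, u, hu, hwu, sub_eq_zero.mp h3, sub_eq_zero.mp h⟩
  have hmem_perp : ∀ i, c ≤ ev i → b i ∈ Uᗮ := by
    intro i hi
    obtain ⟨w, hw, u, hu, hwu, hTw, -⟩ := hsplit i
    have : w = 0 := by
      by_contra hne
      have := hlow w hw hne
      rw [hTw, inner_smul_right] at this
      nlinarith [real_inner_self_nonneg (x := w)]
    rw [hwu, this, zero_add]; exact hu
  have hmem : ∀ i, ev i < c → b i ∈ U := by
    intro i hi
    obtain ⟨w, hw, u, hu, hwu, -, hTu⟩ := hsplit i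
    have : u = 0 := by
      by_contra hne
      have := hhigh u hu hne
      rw [hTu, inner_smul_right] at this
      nlinarith [real_inner_self_nonneg (x := u)]
    rw [hwu, this, add_zero]; exact hw
  have hlead : ∀ i : Fin n, (i : ℕ) < d → b i ∈ Uᗮ := by
    intro i hi
    refine hmem_perp i (le_of_not_gt fun hlt => ?_)
    -- Otherwise `b i` and all later vectors lie in `U`: these are `n - i > n - d = finrank U`
    -- independent vectors.
    have hli : LinearIndependent ℝ
        (fun j : Set.Ici i => (⟨b j, hmem j ((hT.eigenvalues_antitone hn j.2).trans_lt hlt)⟩ : U)) :=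
      LinearIndependent.of_comp U.subtype
        (b.orthonormal.linearIndependent.comp _ Subtype.val_injective)
    have := hli.fintype_card_le_finrank
    simp at this
    omega
  have hdn : d ≤ n := by omega
  have hset : {v | ∃ i : Fin n, (i : ℕ) < d ∧ v = b i} =
      Set.range (fun j : Fin d => b (Fin.castLE hdn j)) := by
    ext v
    constructor
    · rintro ⟨i, hi, rfl⟩
      exact ⟨⟨i, hi⟩, rfl⟩
    · rintro ⟨j, rfl⟩
      exact ⟨Fin.castLE hdn j, j.2, rfl⟩
  refine Submodule.eq_of_le_of_finrank_eq ?_ ?_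
  · rw [Submodule.span_le]
    rintro v ⟨i, hi, rfl⟩
    exact hlead i hi
  · have hli : LinearIndependent ℝ (fun j : Fin d => b (Fin.castLE hdn j)) :=
      b.orthonormal.linearIndependent.comp _ (Fin.castLE_injective hdn)
    rw [hset, finrank_span_eq_card hli, Fintype.card_fin]
    have := U.finrank_add_finrank_orthogonal
    omega

namespace SignalSubspace

variable {L K : ℕ} (H E : Matrix (Fin L) (Fin K) ℝ)

/-! ### Algebra of the projector and the pseudoinverse. -/

theorem toEuclideanLin_mul_apply {l m n : ℕ} (M : Matrix (Fin l) (Fin m) ℝ)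
    (N : Matrix (Fin m) (Fin n) ℝ) (v : EuclideanSpace ℝ (Fin n)) :
    (M * N).toEuclideanLin v = M.toEuclideanLin (N.toEuclideanLin v) := by
  simp

theorem toEuclideanLin_projMatrix (U : Submodule ℝ (EuclideanSpace ℝ (Fin L)))
    (v : EuclideanSpace ℝ (Fin L)) :
    (projMatrix U).toEuclideanLin v = U.starProjection v := by
  simp [projMatrix]

theorem projMatrix_injective :
    Function.Injective (projMatrix : Submodule ℝ (EuclideanSpace ℝ (Fin L)) → _) := by
  intro U V h
  refine Submodule.starProjection_inj.mp (ContinuousLinearMap.ext fun v => ?_)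
  rw [← toEuclideanLin_projMatrix, h, toEuclideanLin_projMatrix]

theorem projMatrix_orthogonal (U : Submodule ℝ (EuclideanSpace ℝ (Fin L))) :
    projMatrix Uᗮ = 1 - projMatrix U := by
  apply Matrix.toEuclideanLin.injective
  ext1 v
  rw [toEuclideanLin_projMatrix, map_sub, LinearMap.sub_apply, toEuclideanLin_projMatrix,
    Submodule.starProjection_orthogonal_val]
  simp

theorem P0perp_eq_projMatrix : P0perp H = projMatrix (U0 H)ᗮ :=
  (projMatrix_orthogonal _).symm

theorem mem_U0 {w : EuclideanSpace ℝ (Fin L)} :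
    w ∈ U0 H ↔ (H * Hᵀ).toEuclideanLin w = 0 := by
  simp [U0]

theorem mul_P0_eq_zero_iff {m : ℕ} (M : Matrix (Fin m) (Fin L) ℝ) :
    M * P0 H = 0 ↔ ∀ w ∈ U0 H, M.toEuclideanLin w = 0 := by
  rw [← Matrix.toEuclideanLin.map_eq_zero_iff, LinearMap.ext_iff]
  simp only [toEuclideanLin_mul_apply, P0, toEuclideanLin_projMatrix, LinearMap.zero_apply]
  constructor
  · intro h w hw
    rw [← h w, Submodule.starProjection_eq_self_iff.mpr hw]
  · intro h v
    exact h _ (Submodule.starProjection_apply_mem _ v)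

theorem P0_transpose : (P0 H)ᵀ = P0 H := by
  have h : (P0 H).toEuclideanLin.IsSymmetric := by
    simpa [P0, projMatrix] using (U0 H).starProjection_isSymmetric
  simpa [Matrix.IsHermitian] using Matrix.isSymmetric_toEuclideanLin_iff.mp h

theorem P0_mul_P0 : P0 H * P0 H = P0 H := by
  apply Matrix.toEuclideanLin.injective
  ext1 v
  rw [toEuclideanLin_mul_apply]
  simp only [P0, toEuclideanLin_projMatrix]
  exact Submodule.starProjection_eq_self_iff.mpr (Submodule.starProjection_apply_mem _ v)

theorem transpose_mul_P0 : Hᵀ * P0 H = 0 := by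
  have h : H * Hᵀ * P0 H = 0 := (mul_P0_eq_zero_iff H _).mpr fun w hw => (mem_U0 H).mp hw
  rw [Matrix.mul_assoc] at h
  have := (Matrix.conjTranspose_mul_self_mul_eq_zero Hᵀ (P0 H)).mp
    (by simpa [Matrix.mul_assoc] using h)
  exact this

theorem P0_mul : P0 H * H = 0 := by
  simpa [P0_transpose] using congrArg Matrix.transpose (transpose_mul_P0 H)

theorem S0_eq_cfc : S0 H = cfc (fun μ : ℝ => μ⁻¹) (H * Hᵀ) :=
  ((isHermitian_mul_transpose H).cfc_eq _).symm

theorem S0_mul_comm : S0 H * (H * Hᵀ) = H * Hᵀ * S0 H := by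
  have hsa : IsSelfAdjoint (H * Hᵀ) := isHermitian_mul_transpose H
  have h := cfc_commute_cfc (fun μ : ℝ => μ⁻¹) (fun μ : ℝ => μ) (H * Hᵀ)
  rw [cfc_id' ℝ (H * Hᵀ), ← S0_eq_cfc] at h
  exact h

theorem S0_transpose : (S0 H)ᵀ = S0 H := by
  rw [S0_eq_cfc]
  have h : IsSelfAdjoint (cfc (fun μ : ℝ => μ⁻¹) (H * Hᵀ)) := cfc_predicate _ _
  simpa [IsSelfAdjoint, Matrix.star_eq_conjTranspose] using h

/-- Exposes a factor `Hᵀ` on the right, so that `S₀` kills whatever `Hᵀ` kills. -/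
theorem S0_eq_S0_mul_S0_mul : S0 H = S0 H * S0 H * (H * Hᵀ) := by
  rw [Matrix.mul_assoc, S0_mul_comm, ← Matrix.mul_assoc, (isPseudoinverse_S0 H).self_mul_mul]

theorem S0_mul_P0 : S0 H * P0 H = 0 := by
  rw [S0_eq_S0_mul_S0_mul]
  simp only [Matrix.mul_assoc, transpose_mul_P0, Matrix.mul_zero]

/-- The pseudoinverse identity for `H Hᵀ`, with the last `Hᵀ` cancelled: `X H Hᵀ = 0` forces `X H =
0` over the reals. -/
theorem gram_mul_S0_mul : H * Hᵀ * S0 H * H = H := by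
  have h := (isPseudoinverse_S0 H).mul_mul_self
  have h2 : (H * Hᵀ * S0 H - 1) * (H * Hᵀ) = 0 := by
    rw [Matrix.sub_mul, h, Matrix.one_mul, sub_self]
  have h3 := (Matrix.mul_self_mul_conjTranspose_eq_zero H (H * Hᵀ * S0 H - 1)).mp
    (by simpa using h2)
  rw [Matrix.sub_mul, Matrix.one_mul] at h3
  exact sub_eq_zero.mp h3

theorem S0_mul_mul_eq_zero_iff {m : ℕ} (X : Matrix (Fin K) (Fin m) ℝ) :
    S0 H * H * X = 0 ↔ H * X = 0 := by
  constructor <;> intro h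
  · rw [← gram_mul_S0_mul H]
    simp only [Matrix.mul_assoc] at h ⊢
    simp [h]
  · rw [Matrix.mul_assoc, h, Matrix.mul_zero]

theorem S0_mul_eq_zero_iff {m : ℕ} (Y : Matrix (Fin L) (Fin m) ℝ) :
    S0 H * Y = 0 ↔ Hᵀ * Y = 0 := by
  constructor <;> intro h
  · have h1 : Hᵀ = Hᵀ * (H * Hᵀ) * S0 H := by
      rw [Matrix.mul_assoc, ← S0_mul_comm]
      simpa [S0_transpose, Matrix.mul_assoc] using
        (congrArg Matrix.transpose (gram_mul_S0_mul H)).symm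
    rw [h1, Matrix.mul_assoc, h, Matrix.mul_zero]
  · rw [S0_eq_S0_mul_S0_mul]
    simp only [Matrix.mul_assoc, h, Matrix.mul_zero]

/-! ### The perturbation and its spectral bounds. -/

theorem Bmat_mul_P0 (δ : ℝ) :
    Bmat H E δ * P0 H = δ • (H * Eᵀ * P0 H) + δ ^ 2 • (E * Eᵀ * P0 H) := by
  simp only [Bmat, Matrix.add_mul, Matrix.smul_mul]
  rw [Matrix.mul_assoc E Hᵀ, transpose_mul_P0, Matrix.mul_zero, add_zero]

theorem S0_mul_Bmat_mul_P0 (δ : ℝ) :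
    S0 H * Bmat H E δ * P0 H =
      δ • (S0 H * H * Eᵀ * P0 H) + δ ^ 2 • (S0 H * E * Eᵀ * P0 H) := by
  rw [Matrix.mul_assoc, Bmat_mul_P0]
  simp only [Matrix.mul_add, Matrix.mul_smul, Matrix.mul_assoc]

theorem gram_perturbation (δ : ℝ) :
    (H + δ • E) * (H + δ • E)ᵀ = H * Hᵀ + Bmat H E δ := by
  simp only [Bmat, Matrix.transpose_add, Matrix.transpose_smul, Matrix.add_mul, Matrix.mul_add,
    Matrix.smul_mul, Matrix.mul_smul, smul_add, smul_smul, sq]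
  abel

theorem finrank_U0_add_rank : Module.finrank ℝ (U0 H) + H.rank = L := by
  have h1 : U0 H = LinearMap.ker (H * Hᵀ).toEuclideanLin := by
    ext w; rw [mem_U0, LinearMap.mem_ker]
  have h2 := LinearMap.finrank_range_add_finrank_ker (H * Hᵀ).toEuclideanLin
  rw [finrank_euclideanSpace_fin, ← h1, Matrix.toEuclideanLin, Matrix.toLpLin_eq_toLin,
    ← Matrix.rank_eq_finrank_range_toLin, Matrix.rank_self_mul_transpose] at h2
  omega

theorem muMin_le {μ : ℝ} (hμ : 0 < μ)
    (h : Module.End.HasEigenvalue (Matrix.toEuclideanLin (H * Hᵀ)) μ) : muMin H ≤ μ :=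
  csInf_le ⟨0, fun _ hx => hx.1.le⟩ ⟨hμ, h⟩

/-- In an eigenbasis, `u` has no component along zero eigenvalues, and all other eigenvalues are at
least `muMin H`. -/
theorem muMin_mul_inner_le {u : EuclideanSpace ℝ (Fin L)} (hu : u ∈ (U0 H)ᗮ) :
    muMin H * inner ℝ u u ≤ inner ℝ u ((H * Hᵀ).toEuclideanLin u) := by
  have hT := Matrix.isSymmetric_toEuclideanLin_iff.mpr (isHermitian_mul_transpose H)
  set b := hT.eigenvectorBasis finrank_euclideanSpace_fin
  set ev := hT.eigenvalues finrank_euclideanSpace_fin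
  have hTb : ∀ i, (H * Hᵀ).toEuclideanLin (b i) = ev i • b i := fun i =>
    hT.apply_eigenvectorBasis finrank_euclideanSpace_fin i
  have hpos : (H * Hᵀ).toEuclideanLin.IsPositive :=
    Matrix.isPositive_toEuclideanLin_iff.mpr (by
      simpa using Matrix.posSemidef_self_mul_conjTranspose H)
  rw [← b.sum_inner_mul_inner u u, ← b.sum_inner_mul_inner u ((H * Hᵀ).toEuclideanLin u),
    Finset.mul_sum]
  refine Finset.sum_le_sum fun i _ => ?_
  rw [← hT (b i) u, hTb, inner_smul_left, real_inner_comm (b i) u]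
  have h0 : 0 ≤ ev i := hpos.nonneg_eigenvalues finrank_euclideanSpace_fin i
  rcases h0.eq_or_lt with h | h
  · have : b i ∈ U0 H := by rw [mem_U0, hTb, ← h, zero_smul]
    rw [hu _ this]; simp
  · have hle := muMin_le H h (hT.hasEigenvalue_eigenvalues finrank_euclideanSpace_fin i)
    simp only [conj_trivial]
    nlinarith [mul_self_nonneg (inner ℝ (b i) u)]

open scoped Matrix.Norms.L2Operator in
theorem abs_inner_toEuclideanLin_le (M : Matrix (Fin L) (Fin L) ℝ)
    (u : EuclideanSpace ℝ (Fin L)) :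
    |inner ℝ u (M.toEuclideanLin u)| ≤ ‖M‖ * inner ℝ u u := by
  have h := (Matrix.toEuclideanCLM (n := Fin L) (𝕜 := ℝ) M).le_opNorm u
  rw [← Matrix.l2_opNorm_toEuclideanCLM, real_inner_self_eq_norm_mul_norm]
  have h1 := abs_real_inner_le_norm u (M.toEuclideanLin u)
  have h2 : ‖M.toEuclideanLin u‖ ≤ ‖Matrix.toEuclideanCLM (n := Fin L) (𝕜 := ℝ) M‖ * ‖u‖ := h
  nlinarith [norm_nonneg u]

open scoped Matrix.Norms.L2Operator in
theorem norm_Bmat_le (δ : ℝ) : ‖Bmat H E δ‖ ≤ Bnorm H E δ := by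
  refine (norm_add_le _ _).trans_eq ?_
  rw [norm_smul, norm_smul, Real.norm_eq_abs, Real.norm_eq_abs, abs_sq, Bnorm]

open scoped Matrix.Norms.L2Operator in
theorem Bnorm_lt_Bnorm (hE : E ≠ 0) {δ δ₀ : ℝ} (h : |δ| < δ₀) :
    Bnorm H E δ < Bnorm H E δ₀ := by
  -- Strictness must come from the quadratic term, since the linear one may vanish.
  have hEE : 0 < ‖E * Eᵀ‖ := by
    rw [norm_pos_iff]
    intro h0
    exact hE (Matrix.self_mul_conjTranspose_eq_zero.mp (by simpa using h0))
  have h0 : |δ| < |δ₀| := h.trans_le (le_abs_self _)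
  have h1 : |δ| * ‖H * Eᵀ + E * Hᵀ‖ ≤ |δ₀| * ‖H * Eᵀ + E * Hᵀ‖ := by gcongr
  have h2 : δ ^ 2 * ‖E * Eᵀ‖ < δ₀ ^ 2 * ‖E * Eᵀ‖ :=
    mul_lt_mul_of_pos_right (sq_lt_sq.mpr h0) hEE
  exact add_lt_add_of_le_of_lt h1 h2

/-! ### Leading subspace versus invariance of `U₀`. -/

theorem map_leadingSubspace {M : Matrix (Fin L) (Fin K) ℝ} {d : ℕ}
    {v : EuclideanSpace ℝ (Fin L)} (hv : v ∈ leadingSubspace M d) :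
    (M * Mᵀ).toEuclideanLin v ∈ leadingSubspace M d := by
  suffices h : leadingSubspace M d ≤
      (leadingSubspace M d).comap (M * Mᵀ).toEuclideanLin from h hv
  refine Submodule.span_le.mpr ?_
  rintro v ⟨i, hi, rfl⟩
  have h := (Matrix.isSymmetric_toEuclideanLin_iff.mpr
    (isHermitian_mul_transpose M)).apply_eigenvectorBasis finrank_euclideanSpace_fin i
  rw [SetLike.mem_coe, Submodule.mem_comap, h]
  exact Submodule.smul_mem _ _ (Submodule.subset_span ⟨i, hi, rfl⟩)

theorem S0_mul_Bmat_mul_P0_eq_zero {δ : ℝ} (h : P0perpPert H E δ = P0perp H) :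
    S0 H * Bmat H E δ * P0 H = 0 := by
  have hspace : leadingSubspace (H + δ • E) H.rank = (U0 H)ᗮ :=
    projMatrix_injective (h.trans (P0perp_eq_projMatrix H))
  have hT := Matrix.isSymmetric_toEuclideanLin_iff.mpr (isHermitian_mul_transpose (H + δ • E))
  have hB : H * Hᵀ * Bmat H E δ * P0 H = 0 := by
    rw [mul_P0_eq_zero_iff]
    intro w hw
    rw [toEuclideanLin_mul_apply, ← mem_U0]
    have hBw : (Bmat H E δ).toEuclideanLin w =
        ((H + δ • E) * (H + δ • E)ᵀ).toEuclideanLin w := by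
      rw [gram_perturbation, map_add, LinearMap.add_apply, (mem_U0 H).mp hw, zero_add]
    -- By symmetry, invariance of `U₀ᗮ` passes to its orthogonal complement `U₀`.
    rw [hBw, ← Submodule.orthogonal_orthogonal (U0 H), Submodule.mem_orthogonal]
    intro u hu
    rw [← hT u w]
    have hTu := map_leadingSubspace (hspace.symm ▸ hu)
    rw [hspace] at hTu
    exact Submodule.inner_left_of_mem_orthogonal hw hTu
  rw [S0_eq_S0_mul_S0_mul]
  simp only [Matrix.mul_assoc] at hB ⊢
  simp [hB]

open scoped Matrix.Norms.L2Operator in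
theorem P0perpPert_eq_P0perp (hE : E ≠ 0) {δ δ₀ : ℝ} (hB : Bnorm H E δ₀ = muMin H / 2)
    (hδ : |δ| < δ₀) (h1 : H * Eᵀ * P0 H = 0) (h2 : Hᵀ * E * Eᵀ * P0 H = 0) :
    P0perpPert H E δ = P0perp H := by
  have hlt : ‖Bmat H E δ‖ < muMin H / 2 :=
    (norm_Bmat_le H E δ).trans_lt (hB ▸ Bnorm_lt_Bnorm H E hE hδ)
  have hAB : H * Hᵀ * Bmat H E δ * P0 H = 0 := by
    rw [Matrix.mul_assoc, Bmat_mul_P0, h1]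
    simp only [Matrix.mul_assoc] at h2 ⊢
    simp [h2]
  have hTapp : ∀ v, ((H + δ • E) * (H + δ • E)ᵀ).toEuclideanLin v =
      (H * Hᵀ).toEuclideanLin v + (Bmat H E δ).toEuclideanLin v := fun v => by
    rw [gram_perturbation, map_add, LinearMap.add_apply]
  rw [P0perp_eq_projMatrix, P0perpPert]
  congr 1
  -- At the level `μ_min / 2`, the form is at most `‖B(δ)‖` on unit vectors of `U₀` and at least
  -- `μ_min - ‖B(δ)‖` on those of `U₀ᗮ`.
  refine span_leading_eigenvectors_eq_orthogonal _ _ (U0 H) ?_ (finrank_U0_add_rank H)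
    (muMin H / 2) ?_ ?_
  · intro w hw
    rw [hTapp, (mem_U0 H).mp hw, zero_add, mem_U0, ← toEuclideanLin_mul_apply]
    exact (mul_P0_eq_zero_iff H _).mp hAB w hw
  · intro w hw hne
    rw [hTapp, (mem_U0 H).mp hw, zero_add]
    have := (abs_le.mp (abs_inner_toEuclideanLin_le (Bmat H E δ) w)).2
    have := real_inner_self_pos.mpr hne
    nlinarith
  · intro u hu hne
    rw [hTapp, inner_add_right]
    have := (abs_le.mp (abs_inner_toEuclideanLin_le (Bmat H E δ) u)).1
    have := muMin_mul_inner_le H hu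
    have := real_inner_self_pos.mpr hne
    nlinarith

theorem eq_zero_of_eventually_smul_add_sq_smul {V : Type*} [AddCommGroup V] [Module ℝ V]
    {x y : V} (h : ∀ᶠ δ in 𝓝 (0 : ℝ), δ • x + δ ^ 2 • y = 0) : x = 0 ∧ y = 0 := by
  obtain ⟨ε, hε, hball⟩ := Metric.eventually_nhds_iff.mp h
  -- Opposite values of `δ` separate the odd term from the even one.
  have hp := hball (y := ε / 2) (by simp [abs_of_pos hε, hε])
  have hm := hball (y := -(ε / 2)) (by simp [abs_of_pos hε, hε])
  have hx : ε • x = 0 := by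
    calc ε • x = ((ε / 2) • x + (ε / 2) ^ 2 • y) - (-(ε / 2) • x + (-(ε / 2)) ^ 2 • y) := by
          module
      _ = 0 := by rw [hp, hm, sub_zero]
  have hx0 : x = 0 := (smul_eq_zero.mp hx).resolve_left hε.ne'
  rw [hx0, smul_zero, zero_add] at hp
  exact ⟨hx0, (smul_eq_zero.mp hp).resolve_left (by positivity)⟩

end SignalSubspace

theorem theorem2 {L K : ℕ} (H E : Matrix (Fin L) (Fin K) ℝ) (hH : H ≠ 0) (hE : E ≠ 0)
    (hrank : H.rank < min L K) (δ₀ : ℝ) (hδ₀ : 0 < δ₀) (hB : Bnorm H E δ₀ = muMin H / 2) :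
    List.TFAE [
      ∀ δ ∈ Set.Ioo (-δ₀) δ₀, P0perpPert H E δ = P0perp H,
      S0 H * H * Eᵀ * P0 H = 0 ∧ S0 H * E * Eᵀ * P0 H = 0,
      ∀ᶠ δ in 𝓝 (0 : ℝ), S0 H * Bmat H E δ * P0 H = 0,
      S0 H * H * Eᵀ * P0 H + P0 H * H * Eᵀ * S0 H = 0 ∧
        S0 H * E * Eᵀ * P0 H + P0 H * E * Eᵀ * S0 H = 0,
      H * Eᵀ * P0 H = 0 ∧ Hᵀ * E * Eᵀ * P0 H = 0] := by
  tfae_have 1 → 3 := fun h => by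
    filter_upwards [Ioo_mem_nhds (neg_lt_zero.mpr hδ₀) hδ₀] with δ hδ
    exact SignalSubspace.S0_mul_Bmat_mul_P0_eq_zero H E (h δ hδ)
  tfae_have 3 → 2 := fun h => by
    simp only [SignalSubspace.S0_mul_Bmat_mul_P0] at h
    exact SignalSubspace.eq_zero_of_eventually_smul_add_sq_smul h
  tfae_have 2 → 4 := fun ⟨h1, h2⟩ => by
    refine ⟨by rw [h1, SignalSubspace.P0_mul]; simp, ?_⟩
    -- The second summand is the transpose of the first.
    have h3 := congrArg Matrix.transpose h2
    simp only [Matrix.transpose_mul, Matrix.transpose_transpose, SignalSubspace.P0_transpose,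
      SignalSubspace.S0_transpose, Matrix.transpose_zero, ← Matrix.mul_assoc] at h3
    rw [h2, h3, add_zero]
  tfae_have 4 → 2 := fun ⟨h1, h2⟩ => by
    refine ⟨by simpa [SignalSubspace.P0_mul] using h1, ?_⟩
    -- Right multiplication by `P₀` keeps the first summand and kills the second, as `S₀ P₀ = 0`.
    have h3 := congrArg (· * P0 H) h2
    simpa [Matrix.add_mul, Matrix.mul_assoc, SignalSubspace.P0_mul_P0,
      SignalSubspace.S0_mul_P0] using h3
  tfae_have 2 ↔ 5 := by
    refine and_congr ?_ ?_
    · simpa only [Matrix.mul_assoc] using SignalSubspace.S0_mul_mul_eq_zero_iff H (Eᵀ * P0 H)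
    · simpa only [Matrix.mul_assoc] using SignalSubspace.S0_mul_eq_zero_iff H (E * (Eᵀ * P0 H))
  tfae_have 5 → 1 := fun ⟨h1, h2⟩ δ hδ =>
    SignalSubspace.P0perpPert_eq_P0perp H E hE hB (abs_lt.mpr hδ) h1 h2
  tfae_finish
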